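/- **Operadic categories.** Let $\mathsf{Fin}$ be the category of finite ordinals $\underline n=\{1,\dots,n\}$, $n\ge 0$, and all maps. For $f:\underline m\to\underline n$ and $i\in\underline n$ let $f^{-1}(i)$ be the inverse image, relabelled as a finite ordinal by its order, with order-preserving injection $\varepsilon_{f,i}:f^{-1}(i)\to\underline m$; this gives functors $\varphi_{\underline n,i}:\mathsf{Fin}/\underline n\to\mathsf{Fin}$. An *operadic category* is a category $\mathbb O$ with a chosen terminal object in each connected component (the *chosen local terminals*), a functor $|\cdot|:\mathbb O\to\mathsf{Fin}$ (cardinality), and for each object $X$ and each $i\in|X|$ a functor $\varphi_{X,i}:\mathbb O/X\to\mathbb O$, written $f\mapsto f^{-1}(i)$ on objects and $g\mapsto g_i$ on morphisms, such that: (1) chosen local terminals have cardinality $\underline 1$; (2) all fibres of identities are chosen local terminals; (3) $|\varphi_{X,i}(-)|=\varphi_{|X|,i}(|-|)$; (4) if $U$ is a chosen local terminal, its fibre functor is the domain functor $\mathbb O/U\to\mathbb O$; (5) for $f:Y\to X$, $i\in|X|$ and $j\in|f^{-1}(i)|$, and $g:Z\to Y$ regarded as a morphism $fg\to f$ over $X$,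 one has $(g_i)^{-1}(j)=g^{-1}(\varepsilon_{|f|,i}(j))$, and the analogous equality holds for morphisms of $\mathbb O/Y$. A *quasibijection* is a morphism all of whose fibres are chosen local terminals. A morphism $f$ is *order-preserving* if $|f|$ is monotone. For a commutative square $\tau f=g\sigma$ with $\sigma:T\to T'$, $g:T'\to S'$, $f:T\to S$, $\tau:S\to S'$, the morphism $\sigma$ is *fibrewise order-preserving* with respect to $\tau$ if all induced morphisms of fibres $\sigma_i:(g\sigma)^{-1}(i)\to g^{-1}(i)$, $i\in|S'|$, are order-preserving. A *pita factorisation* of $f$ is a factorisation $f=\eta\pi$ with $\pi$ a quasibijection and $\eta$ order-preserving; it is fibrewise order-preserving if $\pi$ is so in the square $\mathrm{id}\circ f=\eta\circ\pi$. $\mathbb O$ is *strictly factorisable* if every morphism $f$ has a unique fibrewise order-preserving pita factorisation $f=\eta(f)\pi(f)$, through an object $M(f)$, and for all $f:T\to S$, $g:S\to R$ there is a unique morphism $\eta(f/g):M(gf)\to M(g)$ with $\eta(f/g)\,\pi(gf)=\pi(g)\,f$ and $\eta(g)\,\eta(f/g)=\eta(gf)$. **The pita nerve.** Let $\mathbb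 O$ be strictly factorisable. The objects of the category $W(\mathbb O)_n$ are the chains $T_n\xrightarrow{f_n}\cdots\xrightarrow{f_1}T_0$ in $\mathbb O$; its morphisms are the commutative ladders of quasibijections $\sigma_k:T_k\to S_k$ such that each $\sigma_k$ is fibrewise order-preserving with respect to $\sigma_0$ (in the square formed with the composites $T_k\to T_0$ and $S_k\to S_0$). Let $\mathsf i_n:P(\mathbb O)_n\hookrightarrow W(\mathbb O)_n$ be the full subcategory of those chains for which all composites $h_k:T_k\to T_0$ are order-preserving. There is a functor $\mathsf r_n:W(\mathbb O)_n\to P(\mathbb O)_n$ that sends a chain to the chain of the objects $M(h_k)$ and the morphisms $\eta(f_k/h_{k-1}):M(h_k)\to M(h_{k-1})$, and a ladder $(\sigma_k)$ to the ladder of the unique morphisms $\omega_k:M(h_k)\to M(h'_k)$ with $\omega_k\pi(h_k)=\pi(h'_k)\sigma_k$ and $\eta(h'_k)\omega_k=\sigma_0\eta(h_k)$, where $h'_k:S_k\to S_0$ are the composites of the second chain. The quasibijections $\pi(h_k)$ form a natural transformation $\pi_n:\mathrm{id}\Rightarrow\mathsf i_n\mathsf r_n$. Number the objects of a chain in $W(\mathbb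 O)_n$ from the left, so that the $k$-th one is $T_{n-k}$, $0\le k\le n$. Omitting the $i$-th object, with composition, defines functors $W(\mathbb O)_{n+1}\to W(\mathbb O)_n$; for $0\le i\le n$ they restrict to *face operators* $d_i:P(\mathbb O)_{n+1}\to P(\mathbb O)_n$. Repeating the $i$-th object, with an identity, gives *degeneracy operators* $s_i:P(\mathbb O)_n\to P(\mathbb O)_{n+1}$, $0\le i\le n$. Writing $d_\top:W(\mathbb O)_{n+1}\to W(\mathbb O)_n$ for the functor that omits $T_0$, the *top face operator* is $d_{n+1}:=\mathsf r_n\, d_\top\,\mathsf i_{n+1}:P(\mathbb O)_{n+1}\to P(\mathbb O)_n$. On $P(\mathbb O)_{n+2}$ there is the $2$-cell $$\beta_n:\; d_{n+1}d_{n+1}=\mathsf r_n d_\top d_\top\mathsf i_{n+2}\;\Longrightarrow\;\mathsf r_n d_\top\mathsf i_{n+1}\mathsf r_{n+1}d_\top\mathsf i_{n+2}=d_{n+1}d_{n+2},\qquad \beta_n=\mathsf r_n d_\top\,\pi_{n+1}\,d_\top\mathsf i_{n+2}.$$ **Proposition.** Let $\mathbb O$ be a strictly factorisable operadic category in which all quasibijections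 are invertible. Then every category $P(\mathbb O)_n$ is a groupoid, and the pita nerve is a fully coherent pseudo-simplicial groupoid: there is a pseudofunctor $P:\Delta^{\mathrm{op}}\to\mathbf{Gpd}$ with $P([n])=P(\mathbb O)_n$ whose values on the generating cofaces and codegeneracies are exactly the operators $d_i$ and $s_i$ above (the top face operators included), such that the invertible $2$-cells which it attaches to the simplicial identities are as follows: the one attached to the identity $d_{n+1}d_{n+1}=d_{n+1}d_{n+2}$ on $P(\mathbb O)_{n+2}$ is $\beta_n$ for every $n\ge0$, and the ones attached to all other simplicial identities (between face operators, between degeneracy operators, or between a face and a degeneracy operator) are identities. -/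

import Mathlib

open CategoryTheory

universe v u w

namespace PitaNerve



/-! ### The skeletal category of finite sets and its fibre functors -/

/-- Objects of the skeletal category of finite sets: the finite ordinals. -/
structure SkFin where
  /-- The number of elements. -/
  len : ℕ

/-- Arrows of the skeletal category of finite sets are arbitrary maps. -/
instance : Category SkFin where
  Hom m n := Fin m.len → Fin n.len
  id _ := id
  comp f g := g ∘ f

namespace SkFin

/-- The inverse image of `i` under `f`, as a subset of the domain. -/
def preimage {m n : SkFin} (f : m ⟶ n) (i : Fin n.len) : Finset (Fin m.len) :=
  Finset.univ.filter (fun a => f a = i)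

/-- The order-preserving injection of the fibre over `i` (relabelled as a finite ordinal),
with image the inverse image of `i`. -/
def ε {m n : SkFin} (f : m ⟶ n) (i : Fin n.len) : Fin (preimage f i).card ↪o Fin m.len :=
  (preimage f i).orderEmbOfFin rfl

lemma mem_preimage {m n : SkFin} (f : m ⟶ n) (i : Fin n.len) (b : Fin m.len) :
    b ∈ preimage f i ↔ f b = i := by
  unfold preimage
  rw [Finset.mem_filter]
  exact and_iff_right (Finset.mem_univ b)

lemma ε_spec {m n : SkFin} (f : m ⟶ n) (i : Fin n.len) (a : Fin (preimage f i).card) :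
    f (ε f i a) = i :=
  (mem_preimage f i _).1 ((preimage f i).orderEmbOfFin_mem rfl a)

lemma exists_ε {m n : SkFin} (f : m ⟶ n) (i : Fin n.len) (b : Fin m.len) (hb : f b = i) :
    ∃ a, ε f i a = b := by
  have h := (preimage f i).range_orderEmbOfFin rfl
  have hb' : b ∈ (preimage f i : Set (Fin m.len)) := (mem_preimage f i b).2 hb
  rw [← h] at hb'
  exact hb'

/-- The map induced on the fibres over `i` by `g` over `n`: the one with `ε ∘ g_i = g ∘ ε`. -/
noncomputable def fibreMap {n : SkFin} (i : Fin n.len) {f f' : Over n} (g : f ⟶ f')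
    (a : Fin (preimage f.hom i).card) : Fin (preimage f'.hom i).card :=
  Classical.choose (exists_ε f'.hom i (g.left (ε f.hom i a))
    ((congrFun (Over.w g) _).trans (ε_spec f.hom i a)))

lemma ε_fibreMap {n : SkFin} (i : Fin n.len) {f f' : Over n} (g : f ⟶ f')
    (a : Fin (preimage f.hom i).card) :
    ε f'.hom i (fibreMap i g a) = g.left (ε f.hom i a) :=
  Classical.choose_spec (exists_ε f'.hom i (g.left (ε f.hom i a))
    ((congrFun (Over.w g) _).trans (ε_spec f.hom i a)))

/-- The fibre functor `φ_{n,i} : Fin/n ⥤ Fin` of the skeletal category of finite sets. -/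
noncomputable def fibre (n : SkFin) (i : Fin n.len) : Over n ⥤ SkFin where
  obj f := ⟨(preimage f.hom i).card⟩
  map g := fibreMap i g
  map_id f := funext fun a => (ε f.hom i).injective (ε_fibreMap i (𝟙 f) a)
  map_comp {_ _ f''} g g' := funext fun a => (ε f''.hom i).injective
    ((ε_fibreMap i (g ≫ g') a).trans
      ((ε_fibreMap i g' (fibreMap i g a)).trans (congrArg g'.left (ε_fibreMap i g a))).symm)

end SkFin

/-! ### Operadic categories -/

/-- The structure of an operadic category on a category `O`. The axioms are written as equalities
of functors, so that each of them contains both its clause on objects and its clause on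
morphisms. -/
class OperadicCategory (O : Type u) [Category.{v} O] where
  /-- The chosen terminal object of each connected component. -/
  lt : ConnectedComponents O → O
  /-- Each object has a unique morphism to the chosen object of its component. -/
  uniqueToLt (X : O) : Unique (X ⟶ lt (Quotient.mk _ X))
  /-- The cardinality functor. -/
  card : O ⥤ SkFin
  /-- The fibre functors: `fibre X i` takes `f : Y ⟶ X` to `f⁻¹(i)`. -/
  fibre (X : O) (i : Fin (card.obj X).len) : Over X ⥤ O
  /-- Chosen local terminal objects have cardinality `1`. -/
  card_lt (c : ConnectedComponents O) : card.obj (lt c) = ⟨1⟩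
  /-- The fibres of identities are chosen local terminal objects. -/
  fibre_id (X : O) (i : Fin (card.obj X).len) :
    (fibre X i).obj (Over.mk (𝟙 X)) ∈ Set.range lt
  /-- The fibre functors are compatible with those of finite sets. -/
  fibre_card (X : O) (i : Fin (card.obj X).len) :
    fibre X i ⋙ card = Over.post card ⋙ SkFin.fibre (card.obj X) i
  /-- The fibre functor of a chosen local terminal object is the domain functor. -/
  fibre_lt (c : ConnectedComponents O) (i : Fin (card.obj (lt c)).len) :
    fibre (lt c) i = Over.forget (lt c)
  /-- Fibres of fibre maps are fibres: `(g_i)⁻¹(j) = g⁻¹(ε j)` for `g : Z ⟶ Y` over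
  `f : Y ⟶ X` and `j` in the cardinality of `f⁻¹(i)`, and similarly for fibre maps. -/
  fibre_fibre {X : O} (f : Over X) (i : Fin (card.obj X).len)
      (j : Fin (card.obj ((fibre X i).obj f)).len) :
    Over.iteratedSliceBackward f ⋙ Over.post (fibre X i) ⋙ fibre ((fibre X i).obj f) j =
      fibre f.left (SkFin.ε (card.map f.hom) i
        (Fin.cast (congrArg SkFin.len (Functor.congr_obj (fibre_card X i) f)) j))

variable {O : Type u} [Category.{v} O] [OperadicCategory O]

open OperadicCategory

/-- A chosen local terminal object (also called a trivial object). -/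
def IsChosenLocalTerminal (X : O) : Prop :=
  X ∈ Set.range (lt (O := O))

/-- A quasibijection is a morphism all of whose fibres are chosen local terminal objects. -/
def IsQuasibijection {T S : O} (σ : T ⟶ S) : Prop :=
  ∀ i, IsChosenLocalTerminal ((fibre S i).obj (Over.mk σ))

/-- A morphism is order-preserving if its image under the cardinality functor is monotone. -/
def IsOrderPreserving {T S : O} (f : T ⟶ S) : Prop :=
  Monotone (card.map f : Fin (card.obj T).len → Fin (card.obj S).len)

/-- For a commutative square `f ≫ τ = σ ≫ g`, with `σ : T ⟶ T'`, `g : T' ⟶ S'`, `f : T ⟶ S` and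
`τ : S ⟶ S'`: the morphism `σ` is fibrewise order-preserving with respect to `τ` if the morphisms
which it induces from the fibres of `f ≫ τ = σ ≫ g` to the fibres of `g` are order-preserving. -/
def FibrewiseOrderPreserving {T T' S' : O} (σ : T ⟶ T') (g : T' ⟶ S') : Prop :=
  ∀ i, IsOrderPreserving ((fibre S' i).map (Over.homMk σ : Over.mk (σ ≫ g) ⟶ Over.mk g))

lemma monotone_eqToHom_iff {a b c d : SkFin} (h : a = b) (f : b ⟶ c) (h' : c = d) :
    Monotone (eqToHom h ≫ f ≫ eqToHom h' : Fin a.len → Fin d.len) ↔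
      Monotone (f : Fin b.len → Fin c.len) := by
  subst h h'
  simp

lemma card_map_comp_apply {T S R : O} (f : T ⟶ S) (g : S ⟶ R) (a : Fin (card.obj T).len) :
    card.map (f ≫ g) a = card.map g (card.map f a) :=
  congrFun (card.map_comp f g) a

lemma card_map_id_apply {T : O} (a : Fin (card.obj T).len) : card.map (𝟙 T) a = a :=
  congrFun (card.map_id T) a

lemma SkFin.monotone_fibreMap_iff {n : SkFin} {f f' : Over n} (g : f ⟶ f') :
    (∀ i, Monotone (fibreMap i g)) ↔
      ∀ a b : Fin f.left.len, a ≤ b → f.hom a = f.hom b → g.left a ≤ g.left b := by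
  constructor
  · intro h a b hab e
    obtain ⟨a, rfl⟩ := exists_ε f.hom (f.hom b) a e
    obtain ⟨b', hb⟩ := exists_ε f.hom (f.hom b) b rfl
    have hab' : a ≤ b' := (ε f.hom (f.hom b)).le_iff_le.1 (hab.trans hb.ge)
    have h1 := (ε f'.hom (f.hom b)).le_iff_le.2 (h _ hab')
    rw [ε_fibreMap, ε_fibreMap] at h1
    exact h1.trans (congrArg g.left hb).le
  · intro h i a b hab
    apply (ε f'.hom i).le_iff_le.1
    rw [ε_fibreMap, ε_fibreMap]
    exact h _ _ ((ε f.hom i).le_iff_le.2 hab) ((ε_spec f.hom i a).trans (ε_spec f.hom i b).symm)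

lemma fibrewiseOrderPreserving_iff {T T' S' : O} (σ : T ⟶ T') (g : T' ⟶ S') :
    FibrewiseOrderPreserving σ g ↔ ∀ a b : Fin (card.obj T).len, a ≤ b →
      card.map g (card.map σ a) = card.map g (card.map σ b) →
        card.map σ a ≤ card.map σ b := by
  have key : ∀ i, IsOrderPreserving
      ((fibre S' i).map (Over.homMk σ : Over.mk (σ ≫ g) ⟶ Over.mk g)) ↔
      Monotone (SkFin.fibreMap i
        ((Over.post card).map (Over.homMk σ : Over.mk (σ ≫ g) ⟶ Over.mk g))) := by
    intro i
    have := Functor.congr_hom (fibre_card S' i) (Over.homMk σ : Over.mk (σ ≫ g) ⟶ Over.mk g)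
    unfold IsOrderPreserving
    rw [show card.map ((fibre S' i).map (Over.homMk σ : Over.mk (σ ≫ g) ⟶ Over.mk g)) = _ from
      this]
    exact monotone_eqToHom_iff _ _ _
  refine (forall_congr' key).trans ((SkFin.monotone_fibreMap_iff _).trans ?_)
  refine forall_congr' fun a => forall_congr' fun b => imp_congr_right fun _ => ?_
  exact imp_congr_left (Iff.of_eq (congrArg₂ (· = ·) (card_map_comp_apply σ g a)
    (card_map_comp_apply σ g b)))

lemma IsChosenLocalTerminal.fibre_obj {B : O} (hB : IsChosenLocalTerminal B) {A : O} (m : A ⟶ B)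
    (j) : (fibre B j).obj (Over.mk m) = A := by
  obtain ⟨c, rfl⟩ := hB
  rw [fibre_lt]
  rfl

lemma IsChosenLocalTerminal.card_obj {B : O} (hB : IsChosenLocalTerminal B) :
    card.obj B = ⟨1⟩ := by
  obtain ⟨c, rfl⟩ := hB
  exact card_lt c

lemma isQuasibijection_id (X : O) : IsQuasibijection (𝟙 X) := fun i => fibre_id X i

lemma IsQuasibijection.comp {T S R : O} {f : T ⟶ S} {g : S ⟶ R} (hf : IsQuasibijection f)
    (hg : IsQuasibijection g) : IsQuasibijection (f ≫ g) := by
  intro i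
  have hB := hg i
  have h1 : (card.obj ((fibre R i).obj (Over.mk g))).len = 1 := by rw [hB.card_obj]
  have j : Fin (card.obj ((fibre R i).obj (Over.mk g))).len := Fin.cast h1.symm 0
  have h := Functor.congr_obj (fibre_fibre (Over.mk g) i j) (Over.mk f)
  have h' := hB.fibre_obj
    ((fibre R i).map (Over.homMk f : Over.mk (f ≫ g) ⟶ Over.mk g)) j
  have h'' : (fibre R i).obj (Over.mk (f ≫ g)) = _ := h'.symm.trans h
  rw [h'']
  exact hf _

lemma IsQuasibijection.bijective {T S : O} {σ : T ⟶ S} (h : IsQuasibijection σ) :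
    Function.Bijective (card.map σ : Fin (card.obj T).len → Fin (card.obj S).len) := by
  rw [Function.bijective_iff_existsUnique]
  intro i
  have h1 := (Functor.congr_obj (fibre_card S i) (Over.mk σ)).symm.trans (h i).card_obj
  have h2 : (SkFin.preimage (card.map σ) i).card = 1 := congrArg SkFin.len h1
  obtain ⟨a, ha⟩ := Finset.card_eq_one.1 h2
  have hmem : ∀ b, card.map σ b = i ↔ b = a := fun b => by
    rw [← SkFin.mem_preimage, ha, Finset.mem_singleton]
  exact ⟨a, (hmem a).2 rfl, fun b hb => (hmem b).1 hb⟩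

lemma IsOrderPreserving.comp {T S R : O} {f : T ⟶ S} {g : S ⟶ R} (hf : IsOrderPreserving f)
    (hg : IsOrderPreserving g) : IsOrderPreserving (f ≫ g) := by
  intro a b hab
  rw [card_map_comp_apply, card_map_comp_apply]
  exact hg (hf hab)

lemma isOrderPreserving_id (T : O) : IsOrderPreserving (𝟙 T) := by
  intro a b hab
  rwa [card_map_id_apply, card_map_id_apply]

lemma fibrewiseOrderPreserving_of_isOrderPreserving {T T' S' : O} {σ : T ⟶ T'}
    (h : IsOrderPreserving σ) (g : T' ⟶ S') : FibrewiseOrderPreserving σ g :=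
  (fibrewiseOrderPreserving_iff σ g).2 fun _ _ hab _ => h hab

/-- Being fibrewise order-preserving over `R` implies being so over `S` when `S` maps to `R`. -/
lemma FibrewiseOrderPreserving.of_comp {T T' S R : O} {σ : T ⟶ T'} {a : T' ⟶ S} {b : S ⟶ R}
    (h : FibrewiseOrderPreserving σ (a ≫ b)) : FibrewiseOrderPreserving σ a := by
  rw [fibrewiseOrderPreserving_iff] at h ⊢
  intro x y hxy e
  refine h x y hxy ?_
  rw [card_map_comp_apply, card_map_comp_apply, e]

/-- Horizontal composition of fibrewise order-preserving squares. -/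
lemma FibrewiseOrderPreserving.comp {T T' T'' S' S'' : O} {σ : T ⟶ T'} {b : T' ⟶ S'}
    {ω : T' ⟶ T''} {c : T'' ⟶ S''} {l : S' ⟶ S''} (h : FibrewiseOrderPreserving σ b)
    (h' : FibrewiseOrderPreserving ω c) (hl : IsQuasibijection l) (w : b ≫ l = ω ≫ c) :
    FibrewiseOrderPreserving (σ ≫ ω) c := by
  rw [fibrewiseOrderPreserving_iff] at h h' ⊢
  intro x y hxy e
  rw [card_map_comp_apply, card_map_comp_apply] at e ⊢
  have hw : ∀ z, card.map l (card.map b z) = card.map c (card.map ω z) := fun z =>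
    (card_map_comp_apply b l z).symm.trans
      ((congrArg (fun m => card.map m z) w).trans (card_map_comp_apply ω c z))
  exact h' _ _ (h x y hxy (hl.bijective.1 ((hw _).trans (e.trans (hw _).symm)))) e

/-! ### Strictly factorisable operadic categories -/

/-- A pita factorisation of `f`: a quasibijection followed by an order-preserving morphism. -/
structure PitaFactorisation {T R : O} (f : T ⟶ R) where
  /-- The middle object. -/
  mid : O
  /-- The quasibijection. -/
  π : T ⟶ mid
  /-- The order-preserving morphism. -/
  η : mid ⟶ R
  fac : π ≫ η = f
  isQuasibijection : IsQuasibijection π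
  isOrderPreserving : IsOrderPreserving η

/-- The triangle of the pita factorisation is fibrewise order-preserving. -/
def PitaFactorisation.Fibrewise {T R : O} {f : T ⟶ R} (p : PitaFactorisation f) : Prop :=
  FibrewiseOrderPreserving p.π p.η

variable (O) in
/-- An operadic category is strictly factorisable if it is strongly factorisable (each morphism
has a unique fibrewise order-preserving pita factorisation) and, for each composable pair
`f : T ⟶ S`, `g : S ⟶ R`, there is a unique morphism `η(f/g)` between the middle objects of the
factorisations of `f ≫ g` and `g` that is compatible with `f` and with the identity of `R`. -/
class StrictlyFactorisable : Prop where
  existsUnique_pita {T R : O} (f : T ⟶ R) : ∃! p : PitaFactorisation f, p.Fibrewise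
  existsUnique_lift {T S R : O} (f : T ⟶ S) (g : S ⟶ R) (p : PitaFactorisation (f ≫ g))
    (q : PitaFactorisation g) (hp : p.Fibrewise) (hq : q.Fibrewise) :
    ∃! e : p.mid ⟶ q.mid, p.π ≫ e = f ≫ q.π ∧ e ≫ q.η = p.η

/-- The factorisation of an order-preserving morphism as an identity followed by itself. -/
def PitaFactorisation.ofOrd {T R : O} (f : T ⟶ R) (hf : IsOrderPreserving f) :
    PitaFactorisation f where
  mid := T
  π := 𝟙 T
  η := f
  fac := Category.id_comp f
  isQuasibijection := isQuasibijection_id T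
  isOrderPreserving := hf

lemma PitaFactorisation.ofOrd_fibrewise {T R : O} (f : T ⟶ R) (hf : IsOrderPreserving f) :
    (ofOrd f hf).Fibrewise :=
  fibrewiseOrderPreserving_of_isOrderPreserving (isOrderPreserving_id T) f

/-! ### The categories of chains -/

open SimplexCategory Simplicial

variable (O) in
/-- Objects of the category `W(O)_n`: chains `T_n ⟶ ⋯ ⟶ T_0` of morphisms of `O`, where `T_{n-k}`
is the value at `k`, so that the last object `T_0` of the chain is the value at `Fin.last n`. -/
structure W (a : SimplexCategory) where
  /-- The chain, as a functor. -/
  chain : Fin (a.len + 1) ⥤ O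

/-- The unique morphism to the last element. -/
def toLast {n : ℕ} (k : Fin (n + 1)) : k ⟶ Fin.last n := homOfLE (Fin.le_last k)

/-- Morphisms of `W(O)_n`: commutative ladders of quasibijections, all of which are fibrewise
order-preserving with respect to the last one. -/
@[ext]
structure W.Hom {a : SimplexCategory} (X Y : W O a) where
  /-- The ladder. -/
  app : X.chain ⟶ Y.chain
  isQuasibijection (k : Fin (a.len + 1)) : IsQuasibijection (app.app k)
  fibrewise (k : Fin (a.len + 1)) :
    FibrewiseOrderPreserving (app.app k) (Y.chain.map (toLast k))

instance (a : SimplexCategory) : Category (W O a) where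
  Hom := W.Hom
  id X :=
    { app := 𝟙 X.chain
      isQuasibijection := fun _ => isQuasibijection_id _
      fibrewise := fun _ =>
        fibrewiseOrderPreserving_of_isOrderPreserving (isOrderPreserving_id _) _ }
  comp f g :=
    { app := f.app ≫ g.app
      isQuasibijection := fun k => (f.isQuasibijection k).comp (g.isQuasibijection k)
      fibrewise := fun k => (f.fibrewise k).comp (g.fibrewise k) (g.isQuasibijection _)
        (g.app.naturality _) }
  id_comp f := W.Hom.ext (Category.id_comp f.app)
  comp_id f := W.Hom.ext (Category.comp_id f.app)
  assoc f g h := W.Hom.ext (Category.assoc f.app g.app h.app)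

lemma W.hom_ext {a : SimplexCategory} {X Y : W O a} {f g : X ⟶ Y}
    (h : ∀ k, f.app.app k = g.app.app k) : f = g :=
  W.Hom.ext (NatTrans.ext (funext h))

lemma W.Hom.fibrewise' {a : SimplexCategory} {X Y : W O a} (f : X ⟶ Y)
    {k l : Fin (a.len + 1)} (h : k ⟶ l) :
    FibrewiseOrderPreserving (f.app.app k) (Y.chain.map h) := by
  have := f.fibrewise k
  rw [show toLast k = h ≫ toLast l from Subsingleton.elim _ _, Functor.map_comp] at this
  exact this.of_comp

/-- The simplicial operators of `W(O)`, by precomposition. In particular, the `i`-th face omits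
the `i`-th object of the chain, and the `i`-th degeneracy repeats it. -/
def W.map {a b : SimplexCategory} (α : a ⟶ b) : W O b ⥤ W O a where
  obj X := ⟨α.toOrderHom.monotone.functor ⋙ X.chain⟩
  map f :=
    { app := Functor.whiskerLeft _ f.app
      isQuasibijection := fun _ => f.isQuasibijection _
      fibrewise := fun _ => f.fibrewise' _ }

variable (O) in
lemma W.map_comp {a b c : SimplexCategory} (α : a ⟶ b) (β : b ⟶ c) :
    W.map (O := O) (α ≫ β) = W.map β ⋙ W.map α := rfl

variable (O) in
/-- Locally order-preserving chains: all composites `T_k ⟶ T_0` are order-preserving. -/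
def locallyOrderPreserving (a : SimplexCategory) : ObjectProperty (W O a) :=
  fun X => ∀ k, IsOrderPreserving (X.chain.map (toLast k))

variable (O) in
/-- The category `P(O)_n`: the full subcategory of `W(O)_n` on the locally order-preserving
chains. -/
abbrev P (a : SimplexCategory) := (locallyOrderPreserving O a).FullSubcategory

variable (O) in
/-- The inclusion `i_n` of `P(O)_n` in `W(O)_n`. -/
abbrev incl (a : SimplexCategory) : P O a ⥤ W O a := (locallyOrderPreserving O a).ι

variable (O) in
/-- A simplicial operator that preserves the last element restricts to locally order-preserving
chains. -/
def P.restrict {a b : SimplexCategory} (α : a ⟶ b)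
    (hα : α.toOrderHom (Fin.last a.len) = Fin.last b.len) : P O b ⥤ P O a :=
  (locallyOrderPreserving O a).lift (incl O b ⋙ W.map α) (by
    intro X k
    have h : ∀ (l : Fin (b.len + 1)) (m : α.toOrderHom k ⟶ l), l = Fin.last _ →
        IsOrderPreserving (X.obj.chain.map m) := by
      rintro _ m rfl
      exact X.property _
    exact h _ _ hα)

variable [StrictlyFactorisable O]

/-- The pita factorisation of `f`. -/
noncomputable def pita {T R : O} (f : T ⟶ R) : PitaFactorisation f :=
  (StrictlyFactorisable.existsUnique_pita f).choose

lemma pita_fibrewise {T R : O} (f : T ⟶ R) : (pita f).Fibrewise :=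
  (StrictlyFactorisable.existsUnique_pita f).choose_spec.1

lemma PitaFactorisation.Fibrewise.eq {T R : O} {f : T ⟶ R} {p q : PitaFactorisation f}
    (hp : p.Fibrewise) (hq : q.Fibrewise) : p = q :=
  (StrictlyFactorisable.existsUnique_pita f).unique hp hq

lemma existsUnique_etaLift {T S R : O} (f : T ⟶ S) (g : S ⟶ R) (h : T ⟶ R) (w : f ≫ g = h) :
    ∃! e : (pita h).mid ⟶ (pita g).mid,
      (pita h).π ≫ e = f ≫ (pita g).π ∧ e ≫ (pita g).η = (pita h).η := by
  subst w
  exact StrictlyFactorisable.existsUnique_lift f g _ _ (pita_fibrewise _) (pita_fibrewise _)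

/-- The morphism `η(f/g)`, for `h` the composite of `f : T ⟶ S` and `g : S ⟶ R`. -/
noncomputable def etaLift {T S R : O} (f : T ⟶ S) (g : S ⟶ R) (h : T ⟶ R) (w : f ≫ g = h) :
    (pita h).mid ⟶ (pita g).mid :=
  (existsUnique_etaLift f g h w).choose

lemma π_etaLift {T S R : O} (f : T ⟶ S) (g : S ⟶ R) (h : T ⟶ R) (w : f ≫ g = h) :
    (pita h).π ≫ etaLift f g h w = f ≫ (pita g).π :=
  (existsUnique_etaLift f g h w).choose_spec.1.1

lemma etaLift_η {T S R : O} (f : T ⟶ S) (g : S ⟶ R) (h : T ⟶ R) (w : f ≫ g = h) :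
    etaLift f g h w ≫ (pita g).η = (pita h).η :=
  (existsUnique_etaLift f g h w).choose_spec.1.2

lemma pita_hom_ext {T S' T'' : O} {h : T ⟶ S'} {p : PitaFactorisation h} (hp : p.Fibrewise)
    {g : T'' ⟶ S'} (hg : IsOrderPreserving g) {u : T ⟶ T''} {e e' : p.mid ⟶ T''}
    (h1 : p.π ≫ e = u) (h1' : p.π ≫ e' = u) (h2 : e ≫ g = p.η) (h2' : e' ≫ g = p.η) :
    e = e' := by
  have w : u ≫ g = h := by rw [← h1, Category.assoc, h2, p.fac]
  subst w
  refine (StrictlyFactorisable.existsUnique_lift u g p (.ofOrd g hg) hp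
    (PitaFactorisation.ofOrd_fibrewise g hg)).unique ⟨?_, h2⟩ ⟨?_, h2'⟩
  · exact h1.trans (Category.comp_id u).symm
  · exact h1'.trans (Category.comp_id u).symm

/-- The pasting of the pita factorisations of `f` and of `η(f) ≫ τ`, for `τ` a quasibijection. -/
noncomputable def pastedPita {T S S' : O} (f : T ⟶ S) {τ : S ⟶ S'} :
    PitaFactorisation (f ≫ τ) where
  mid := (pita ((pita f).η ≫ τ)).mid
  π := (pita f).π ≫ (pita ((pita f).η ≫ τ)).π
  η := (pita ((pita f).η ≫ τ)).η
  fac := by rw [Category.assoc, PitaFactorisation.fac, ← Category.assoc, PitaFactorisation.fac]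
  isQuasibijection := (pita f).isQuasibijection.comp (pita _).isQuasibijection
  isOrderPreserving := (pita _).isOrderPreserving

lemma pastedPita_fibrewise {T S S' : O} (f : T ⟶ S) {τ : S ⟶ S'} (hτ : IsQuasibijection τ) :
    (pastedPita f (τ := τ)).Fibrewise :=
  FibrewiseOrderPreserving.comp (pita_fibrewise f) (pita_fibrewise _) hτ
    (PitaFactorisation.fac _).symm

lemma omega_ext {T S S' T'' : O} (f : T ⟶ S) {τ : S ⟶ S'} (hτ : IsQuasibijection τ)
    {g : T'' ⟶ S'} (hg : IsOrderPreserving g) {ω ω' : (pita f).mid ⟶ T''}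
    (h : (pita f).π ≫ ω = (pita f).π ≫ ω') (h1 : ω ≫ g = (pita f).η ≫ τ)
    (h1' : ω' ≫ g = (pita f).η ≫ τ) : ω = ω' := by
  have key : ∀ ω : (pita f).mid ⟶ T'', ω ≫ g = (pita f).η ≫ τ →
      ∃ α, (pita ((pita f).η ≫ τ)).π ≫ α = ω ∧ α ≫ g = (pita ((pita f).η ≫ τ)).η := by
    intro ω hω
    rw [← hω]
    obtain ⟨α, ⟨h1, h2⟩, -⟩ := StrictlyFactorisable.existsUnique_lift ω g (pita (ω ≫ g))
      (.ofOrd g hg) (pita_fibrewise _) (PitaFactorisation.ofOrd_fibrewise g hg)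
    exact ⟨α, h1.trans (Category.comp_id ω), h2⟩
  obtain ⟨α, ha, ha'⟩ := key ω h1
  obtain ⟨α', hb, hb'⟩ := key ω' h1'
  have : α = α' := pita_hom_ext (p := pastedPita f (τ := τ)) (pastedPita_fibrewise f hτ) hg
    (u := (pita f).π ≫ ω) ((Category.assoc _ _ _).trans (congrArg _ ha))
    ((Category.assoc _ _ _).trans ((congrArg _ hb).trans h.symm)) ha' hb'
  rw [← ha, ← hb, this]

/-- A fibrewise order-preserving square with horizontal quasibijections induces a morphism between
the order-preserving parts of its vertical sides. -/
lemma exists_omega {T S T' S' : O} {f : T ⟶ S} {g : T' ⟶ S'} {σ : T ⟶ T'} {τ : S ⟶ S'}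
    (hσ : IsQuasibijection σ) (hτ : IsQuasibijection τ) (h : FibrewiseOrderPreserving σ g)
    (w : f ≫ τ = σ ≫ g) :
    ∃ ω : (pita f).mid ⟶ (pita g).mid, IsQuasibijection ω ∧
      FibrewiseOrderPreserving ω (pita g).η ∧ (pita f).π ≫ ω = σ ≫ (pita g).π ∧
      ω ≫ (pita g).η = (pita f).η ≫ τ := by
  let q : PitaFactorisation (f ≫ τ) :=
    { mid := (pita g).mid
      π := σ ≫ (pita g).π
      η := (pita g).η
      fac := by rw [Category.assoc, PitaFactorisation.fac, w]
      isQuasibijection := hσ.comp (pita g).isQuasibijection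
      isOrderPreserving := (pita g).isOrderPreserving }
  have hq : q.Fibrewise := FibrewiseOrderPreserving.comp h (pita_fibrewise g)
    (isQuasibijection_id _) ((Category.comp_id _).trans (pita g).fac.symm)
  have e := (pastedPita_fibrewise f hτ).eq hq
  have : ∀ q : PitaFactorisation (f ≫ τ), pastedPita f = q →
      ∃ ω : (pita f).mid ⟶ q.mid, IsQuasibijection ω ∧
      FibrewiseOrderPreserving ω q.η ∧ (pita f).π ≫ ω = q.π ∧ ω ≫ q.η = (pita f).η ≫ τ := by
    rintro _ rfl
    exact ⟨(pita ((pita f).η ≫ τ)).π, (pita _).isQuasibijection, pita_fibrewise _, rfl,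
      (pita _).fac⟩
  exact this q e

/-! ### The reflections -/

/-- The chain `T'_n ⟶ ⋯ ⟶ T'_0` of the morphisms `η(f_k / f_1 ⋯ f_{k-1})`. -/
noncomputable def reflChain {a : SimplexCategory} (X : W O a) : Fin (a.len + 1) ⥤ O where
  obj k := (pita (X.chain.map (toLast k))).mid
  map {k l} m := etaLift (X.chain.map m) (X.chain.map (toLast l)) (X.chain.map (toLast k))
    (by rw [← Functor.map_comp]; rfl)
  map_id k := by
    refine (existsUnique_etaLift (X.chain.map (𝟙 k)) (X.chain.map (toLast k)) _
      (by rw [← Functor.map_comp]; rfl)).unique ⟨π_etaLift _ _ _ _, etaLift_η _ _ _ _⟩ ⟨?_, ?_⟩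
    · simp
    · simp
  map_comp {k l m} f g := by
    refine (existsUnique_etaLift (X.chain.map (f ≫ g)) (X.chain.map (toLast m)) _
      (by rw [← Functor.map_comp]; rfl)).unique ⟨π_etaLift _ _ _ _, etaLift_η _ _ _ _⟩ ⟨?_, ?_⟩
    · rw [← Category.assoc, π_etaLift, Category.assoc, π_etaLift, Functor.map_comp,
        Category.assoc]
    · rw [Category.assoc, etaLift_η, etaLift_η]

lemma pita_id_η_strictMono (T : O) : StrictMono
    (card.map (pita (𝟙 T)).η : Fin (card.obj (pita (𝟙 T)).mid).len → Fin (card.obj T).len) := by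
  have h : ∀ p : PitaFactorisation (𝟙 T), p = .ofOrd (𝟙 T) (isOrderPreserving_id T) →
      StrictMono (card.map p.η : Fin (card.obj p.mid).len → Fin (card.obj T).len) := by
    rintro _ rfl a b hab
    exact (card_map_id_apply a).trans_lt (hab.trans_eq (card_map_id_apply b).symm)
  exact h _ ((pita_fibrewise _).eq (PitaFactorisation.ofOrd_fibrewise _ _))

lemma pita_η_strictMono {T : O} (f : T ⟶ T) (hf : f = 𝟙 T) : StrictMono
    (card.map (pita f).η : Fin (card.obj (pita f).mid).len → Fin (card.obj T).len) := by
  subst hf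
  exact pita_id_η_strictMono T

lemma reflChain_locallyOrderPreserving {a : SimplexCategory} (X : W O a) :
    locallyOrderPreserving O a ⟨reflChain X⟩ := by
  intro k x y hxy
  have hm := pita_η_strictMono (X.chain.map (toLast (Fin.last a.len))) (X.chain.map_id _)
  have h := etaLift_η (X.chain.map (toLast k)) (X.chain.map (toLast (Fin.last a.len)))
    (X.chain.map (toLast k)) (X.chain.map_comp _ _).symm
  have h' : ∀ z, card.map (pita (X.chain.map (toLast (Fin.last a.len)))).η (card.map
      (etaLift (X.chain.map (toLast k)) (X.chain.map (toLast (Fin.last a.len)))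
        (X.chain.map (toLast k)) (X.chain.map_comp _ _).symm) z) =
      card.map (pita (X.chain.map (toLast k))).η z := fun z =>
    (card_map_comp_apply _ _ z).symm.trans (congrArg (fun m => card.map m z) h)
  exact hm.le_iff_le.1 (((h' x).trans_le ((pita _).isOrderPreserving hxy)).trans_eq (h' y).symm)

lemma exists_reflMap {a : SimplexCategory} {X Y : W O a} (f : X ⟶ Y) (k : Fin (a.len + 1)) :
    ∃ ω : (pita (X.chain.map (toLast k))).mid ⟶ (pita (Y.chain.map (toLast k))).mid,
      IsQuasibijection ω ∧ FibrewiseOrderPreserving ω (pita (Y.chain.map (toLast k))).η ∧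
      (pita (X.chain.map (toLast k))).π ≫ ω = f.app.app k ≫ (pita (Y.chain.map (toLast k))).π ∧
      ω ≫ (pita (Y.chain.map (toLast k))).η =
        (pita (X.chain.map (toLast k))).η ≫ f.app.app (Fin.last a.len) :=
  exists_omega (f.isQuasibijection k) (f.isQuasibijection _) (f.fibrewise k)
    (f.app.naturality _)

/-- The components `ω` of the reflection of a morphism of `W(O)_n`: the morphisms making the
prisms between `f` and its reflection commute. -/
noncomputable def reflApp {a : SimplexCategory} {X Y : W O a} (f : X ⟶ Y)
    (k : Fin (a.len + 1)) :
    (pita (X.chain.map (toLast k))).mid ⟶ (pita (Y.chain.map (toLast k))).mid :=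
  (exists_reflMap f k).choose

lemma reflApp_isQuasibijection {a : SimplexCategory} {X Y : W O a} (f : X ⟶ Y)
    (k : Fin (a.len + 1)) : IsQuasibijection (reflApp f k) :=
  (exists_reflMap f k).choose_spec.1

lemma reflApp_fibrewise {a : SimplexCategory} {X Y : W O a} (f : X ⟶ Y)
    (k : Fin (a.len + 1)) :
    FibrewiseOrderPreserving (reflApp f k) (pita (Y.chain.map (toLast k))).η :=
  (exists_reflMap f k).choose_spec.2.1

lemma π_reflApp {a : SimplexCategory} {X Y : W O a} (f : X ⟶ Y) (k : Fin (a.len + 1)) :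
    (pita (X.chain.map (toLast k))).π ≫ reflApp f k =
      f.app.app k ≫ (pita (Y.chain.map (toLast k))).π :=
  (exists_reflMap f k).choose_spec.2.2.1

lemma reflApp_η {a : SimplexCategory} {X Y : W O a} (f : X ⟶ Y) (k : Fin (a.len + 1)) :
    reflApp f k ≫ (pita (Y.chain.map (toLast k))).η =
        (pita (X.chain.map (toLast k))).η ≫ f.app.app (Fin.last a.len) :=
  (exists_reflMap f k).choose_spec.2.2.2

lemma reflApp_naturality {a : SimplexCategory} {X Y : W O a} (f : X ⟶ Y)
    {k l : Fin (a.len + 1)} (m : k ⟶ l) :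
    etaLift (X.chain.map m) (X.chain.map (toLast l)) (X.chain.map (toLast k))
        (X.chain.map_comp m (toLast l)).symm ≫ reflApp f l =
      reflApp f k ≫ etaLift (Y.chain.map m) (Y.chain.map (toLast l)) (Y.chain.map (toLast k))
        (Y.chain.map_comp m (toLast l)).symm := by
  refine omega_ext (X.chain.map (toLast k)) (f.isQuasibijection (Fin.last _))
    (pita (Y.chain.map (toLast l))).isOrderPreserving ?_ ?_ ?_
  · rw [← Category.assoc, π_etaLift, Category.assoc, π_reflApp,
      ← Category.assoc (pita (X.chain.map (toLast k))).π, π_reflApp, Category.assoc, π_etaLift,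
      f.app.naturality_assoc]
  · rw [Category.assoc, reflApp_η, ← Category.assoc, etaLift_η]
  · rw [Category.assoc, etaLift_η, reflApp_η]

lemma reflApp_id {a : SimplexCategory} (X : W O a) (k : Fin (a.len + 1)) :
    reflApp (𝟙 X) k = 𝟙 _ := by
  refine omega_ext (X.chain.map (toLast k)) (isQuasibijection_id _)
    (pita (X.chain.map (toLast k))).isOrderPreserving ?_ (reflApp_η (𝟙 X) k) ?_
  · refine (π_reflApp (𝟙 X) k).trans ?_
    exact (Category.id_comp _).trans (Category.comp_id _).symm
  · exact (Category.id_comp _).trans (Category.comp_id _).symm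

lemma reflApp_comp {a : SimplexCategory} {X Y Z : W O a} (f : X ⟶ Y) (g : Y ⟶ Z)
    (k : Fin (a.len + 1)) : reflApp (f ≫ g) k = reflApp f k ≫ reflApp g k := by
  refine omega_ext (X.chain.map (toLast k)) ((f ≫ g).isQuasibijection (Fin.last _))
    (pita (Z.chain.map (toLast k))).isOrderPreserving ?_ (reflApp_η (f ≫ g) k) ?_
  · refine (π_reflApp (f ≫ g) k).trans ?_
    rw [← Category.assoc, π_reflApp, Category.assoc, π_reflApp]
    exact Category.assoc _ _ _
  · rw [Category.assoc, reflApp_η, ← Category.assoc, reflApp_η]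
    exact Category.assoc _ _ _

/-- The reflection of a morphism of `W(O)_n`. -/
noncomputable def reflMap {a : SimplexCategory} {X Y : W O a} (f : X ⟶ Y) :
    (⟨reflChain X⟩ : W O a) ⟶ ⟨reflChain Y⟩ :=
  W.Hom.mk
    { app := reflApp f
      naturality := fun _ _ m => reflApp_naturality f m }
    (fun k => reflApp_isQuasibijection f k)
    (fun k => by
      have := reflApp_fibrewise f k
      rw [← etaLift_η (Y.chain.map (toLast k)) (Y.chain.map (toLast (Fin.last a.len)))
        (Y.chain.map (toLast k))
        (Y.chain.map_comp _ _).symm] at this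
      exact this.of_comp)

variable (O) in
/-- The reflection `r_n : W(O)_n ⥤ P(O)_n`. -/
noncomputable def refl (a : SimplexCategory) : W O a ⥤ P O a where
  obj X := ⟨⟨reflChain X⟩, reflChain_locallyOrderPreserving X⟩
  map f := ObjectProperty.homMk (reflMap f)
  map_id X := ObjectProperty.hom_ext _ (W.hom_ext fun k => reflApp_id X k)
  map_comp f g := ObjectProperty.hom_ext _ (W.hom_ext fun k => reflApp_comp f g k)

variable (O) in
/-- The unit `π_n` of the reflection, given by the quasibijections `π(f_1 ⋯ f_k)`. -/
noncomputable def unit (a : SimplexCategory) : 𝟭 (W O a) ⟶ refl O a ⋙ incl O a where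
  app X := W.Hom.mk
    { app := fun k => (pita (X.chain.map (toLast k))).π
      naturality := fun k l m => (π_etaLift (X.chain.map m) (X.chain.map (toLast l))
        (X.chain.map (toLast k)) (X.chain.map_comp m (toLast l)).symm).symm }
    (fun k => (pita (X.chain.map (toLast k))).isQuasibijection)
    (fun k => by
      have := pita_fibrewise (X.chain.map (toLast k))
      unfold PitaFactorisation.Fibrewise at this
      rw [← etaLift_η (X.chain.map (toLast k)) (X.chain.map (toLast (Fin.last a.len)))
        (X.chain.map (toLast k))
        (X.chain.map_comp _ _).symm] at this
      exact this.of_comp)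
  naturality X Y f := W.hom_ext fun k => (π_reflApp f k).symm

/-! ### The pita nerve -/

lemma δ_castSucc_last {n : ℕ} (i : Fin (n + 1)) :
    (δ (i.castSucc : Fin (n + 2))).toOrderHom (Fin.last _) = Fin.last _ :=
  Fin.succAbove_of_le_castSucc _ _ (Fin.castSucc_le_castSucc_iff.2 (Fin.le_last i))

lemma σ_last {n : ℕ} (i : Fin (n + 1)) :
    (σ i).toOrderHom (Fin.last _) = Fin.last _ :=
  Fin.predAbove_right_last

variable (O) in
/-- The face operators `d_i : P(O)_{n+1} ⥤ P(O)_n`, for `i ≤ n`. -/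
def face (n : ℕ) (i : Fin (n + 1)) : P O ⦋n + 1⦌ ⥤ P O ⦋n⦌ :=
  P.restrict O (δ i.castSucc) (δ_castSucc_last i)

variable (O) in
/-- The degeneracy operators `s_i : P(O)_n ⥤ P(O)_{n+1}`. -/
def degeneracy (n : ℕ) (i : Fin (n + 1)) : P O ⦋n⦌ ⥤ P O ⦋n + 1⦌ :=
  P.restrict O (σ i) (σ_last i)

variable (O) in
/-- The top face operator `d_{n+1} : P(O)_{n+1} ⥤ P(O)_n`: include in `W(O)_{n+1}`, omit the last
object, and reflect back. -/
noncomputable def topFace (n : ℕ) : P O ⦋n + 1⦌ ⥤ P O ⦋n⦌ :=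
  incl O ⦋n + 1⦌ ⋙ W.map (δ (Fin.last (n + 1))) ⋙ refl O ⦋n⦌

variable (O) in
lemma face_comp_topFace (n : ℕ) : face O (n + 1) (Fin.last (n + 1)) ⋙ topFace O n =
    (incl O ⦋n + 2⦌ ⋙ W.map (δ (Fin.last (n + 2)))) ⋙ 𝟭 (W O ⦋n + 1⦌) ⋙
      W.map (δ (Fin.last (n + 1))) ⋙ refl O ⦋n⦌ := by
  have h := congrArg (fun α => incl O ⦋n + 2⦌ ⋙ W.map (O := O) α ⋙ refl O ⦋n⦌)
    (δ_comp_δ_self (i := Fin.last (n + 1)))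
  exact h

variable (O) in
/-- The `2`-cell `β_n : d_{n+1} d_{n+1} ⟶ d_{n+1} d_{n+2}` (composites of operators), obtained
from the unit of the reflection on `W(O)_{n+1}`. -/
noncomputable def β (n : ℕ) :
    face O (n + 1) (Fin.last (n + 1)) ⋙ topFace O n ⟶ topFace O (n + 1) ⋙ topFace O n :=
  eqToHom (face_comp_topFace O n) ≫
    Functor.whiskerLeft (incl O ⦋n + 2⦌ ⋙ W.map (δ (Fin.last (n + 2))))
      (Functor.whiskerRight (unit O ⦋n + 1⦌) (W.map (δ (Fin.last (n + 1))) ⋙ refl O ⦋n⦌))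

/-! ### Pseudo-simplicial groupoids -/

/-- The `2`-category of groupoids: the full sub-`2`-category of the `2`-category of categories on
the groupoids. -/
abbrev Gpd :=
  Bicategory.InducedBicategory Cat.{v, w} (Subtype.val : {C : Cat.{v, w} // IsGroupoid C} → Cat)

/-- The data of a pseudofunctor with given values `X_a` on the objects of the opposite of the
simplex category, see `PseudoSimplicial.toPseudofunctor`. -/
structure PseudoSimplicial (X : SimplexCategory → Type w) [∀ a, Category.{v} (X a)] where
  /-- The functor attached to a simplicial operator. -/
  map {a b : SimplexCategory} (α : a ⟶ b) : X b ⥤ X a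
  /-- The unit constraint. -/
  mapId (a : SimplexCategory) : map (𝟙 a) ≅ 𝟭 (X a)
  /-- The composition constraint. -/
  mapComp {a b c : SimplexCategory} (α : a ⟶ b) (γ : b ⟶ c) : map (α ≫ γ) ≅ map γ ⋙ map α
  map_assoc {a b c d : SimplexCategory} (α : a ⟶ b) (γ : b ⟶ c) (κ : c ⟶ d) (x : X d) :
    (mapComp (α ≫ γ) κ).hom.app x ≫ (mapComp α γ).hom.app ((map κ).obj x) =
      eqToHom (by rw [Category.assoc]) ≫ (mapComp α (γ ≫ κ)).hom.app x ≫
        (map α).map ((mapComp γ κ).hom.app x)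
  map_id_comp {a b : SimplexCategory} (α : a ⟶ b) (x : X b) :
    (mapComp (𝟙 a) α).hom.app x ≫ (mapId a).hom.app ((map α).obj x) =
      eqToHom (by rw [Category.id_comp]; rfl)
  map_comp_id {a b : SimplexCategory} (α : a ⟶ b) (x : X b) :
    (mapComp α (𝟙 b)).hom.app x ≫ (map α).map ((mapId b).hom.app x) =
      eqToHom (by rw [Category.comp_id]; rfl)

namespace PseudoSimplicial

variable {X : SimplexCategory → Type w} [∀ a, Category.{v} (X a)]

lemma map_assoc_inv (S : PseudoSimplicial X) {a b c d : SimplexCategory} (α : a ⟶ b)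
    (γ : b ⟶ c) (κ : c ⟶ d) (x : X d) :
    (S.mapComp α (γ ≫ κ)).hom.app x ≫ (S.map α).map ((S.mapComp γ κ).hom.app x) ≫
      (S.mapComp α γ).inv.app ((S.map κ).obj x) ≫ (S.mapComp (α ≫ γ) κ).inv.app x =
      eqToHom (by rw [Category.assoc]) := by
  rw [← cancel_epi (eqToHom (by rw [Category.assoc]) :
    (S.map ((α ≫ γ) ≫ κ)).obj x ⟶ (S.map (α ≫ γ ≫ κ)).obj x)]
  have e := congrArg (fun m => m ≫ (S.mapComp α γ).inv.app ((S.map κ).obj x) ≫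
    (S.mapComp (α ≫ γ) κ).inv.app x) (S.map_assoc α γ κ x)
  simp only [Category.assoc, Iso.hom_inv_id_app_assoc] at e
  rw [← e, Iso.hom_inv_id_app, eqToHom_trans, eqToHom_refl]

/-- The pseudofunctor from the opposite of the simplex category to categories. -/
def toCat (S : PseudoSimplicial X) :
    Pseudofunctor (LocallyDiscrete SimplexCategoryᵒᵖ) Cat.{v, w} :=
  pseudofunctorOfIsLocallyDiscrete
    (fun a => Cat.of (X a.as.unop))
    (fun f => (S.map f.as.unop).toCatHom)
    (fun a => Cat.Hom.isoMk (S.mapId a.as.unop))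
    (fun f g => Cat.Hom.isoMk (S.mapComp g.as.unop f.as.unop))
    (fun f g h => by
      ext x
      refine Eq.trans ?_ (Cat.eqToHom_app _ _ _ _).symm
      refine Eq.trans ?_ (S.map_assoc_inv h.as.unop g.as.unop f.as.unop x)
      exact congrArg (fun m => (S.mapComp h.as.unop (g.as.unop ≫ f.as.unop)).hom.app x ≫
        (S.map h.as.unop).map ((S.mapComp g.as.unop f.as.unop).hom.app x) ≫ m)
        (Category.id_comp _))
    (fun f => by
      ext x
      refine Eq.trans ?_ (Cat.eqToHom_app _ _ _ _).symm
      refine Eq.trans ?_ (S.map_comp_id f.as.unop x)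
      exact (Category.assoc _ _ _).symm.trans (Category.comp_id _))
    (fun f => by
      ext x
      refine Eq.trans ?_ (Cat.eqToHom_app _ _ _ _).symm
      refine Eq.trans ?_ (S.map_id_comp f.as.unop x)
      exact (Category.assoc _ _ _).symm.trans (Category.comp_id _))

/-- The pseudofunctor from the opposite of the simplex category to groupoids. -/
def toPseudofunctor (S : PseudoSimplicial X) (h : ∀ a, IsGroupoid (X a)) :
    Pseudofunctor (LocallyDiscrete SimplexCategoryᵒᵖ) Gpd.{v, w} :=
  pseudofunctorOfIsLocallyDiscrete
    (fun a => ⟨Cat.of (X a.as.unop), h a.as.unop⟩)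
    (fun f => Bicategory.InducedBicategory.mkHom (S.toCat.map f))
    (fun a => Bicategory.InducedBicategory.isoMk (S.toCat.mapId a))
    (fun f g => Bicategory.InducedBicategory.isoMk (S.toCat.mapComp f g))
    (fun f g h => by
      apply Bicategory.InducedBicategory.hom₂_ext
      refine Eq.trans ?_ (Bicategory.InducedBicategory.eqToHom_hom _).symm
      exact (S.toCat.map₂_associator f g h).symm)
    (fun f => by
      apply Bicategory.InducedBicategory.hom₂_ext
      refine Eq.trans ?_ (Bicategory.InducedBicategory.eqToHom_hom _).symm
      exact (S.toCat.map₂_left_unitor f).symm)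
    (fun f => by
      apply Bicategory.InducedBicategory.hom₂_ext
      refine Eq.trans ?_ (Bicategory.InducedBicategory.eqToHom_hom _).symm
      exact (S.toCat.map₂_right_unitor f).symm)

end PseudoSimplicial
namespace PseudoSimplicial

variable {X : SimplexCategory → Type w} [∀ a, Category.{v} (X a)]

/-- The `2`-cell of a pseudofunctor attached to a commutative square of simplicial operators. -/
def square (S : PseudoSimplicial X) {a b b' c : SimplexCategory} {α : a ⟶ b} {γ : b ⟶ c}
    {α' : a ⟶ b'} {γ' : b' ⟶ c} (h : α ≫ γ = α' ≫ γ') :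
    S.map γ ⋙ S.map α ≅ S.map γ' ⋙ S.map α' :=
  (S.mapComp α γ).symm ≪≫ eqToIso (congrArg S.map h) ≪≫ S.mapComp α' γ'

/-- The `2`-cell of a pseudofunctor attached to a section of a simplicial operator. -/
def triangle (S : PseudoSimplicial X) {a b : SimplexCategory} {α : a ⟶ b} {γ : b ⟶ a}
    (h : α ≫ γ = 𝟙 a) : 𝟭 (X a) ≅ S.map γ ⋙ S.map α :=
  (S.mapId a).symm ≪≫ eqToIso (congrArg S.map h.symm) ≪≫ S.mapComp α γ

end PseudoSimplicial

/-- A natural transformation is an identity: its source and target are equal functors, and it is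
the identity modulo this equality. -/
def IsIdentity {C : Type*} [Category* C] {D : Type*} [Category* D] {F G : C ⥤ D} (t : F ⟶ G) :
    Prop :=
  ∃ h : F = G, t = eqToHom h

/-- The pseudo-simplicial object `S` with values `P(O)_n` extends the pre-simplicial data of the
pita nerve: it has its face and degeneracy operators, the `2`-cells attached by `S` to pairs of
consecutive top face operators are the cells `β_n`, and those attached to all other simplicial
identities are identities. -/
structure PseudoSimplicial.IsPitaNerve (S : PseudoSimplicial (P O)) : Prop where
  map_face (n : ℕ) (i : Fin (n + 1)) : S.map (δ i.castSucc) = face O n i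
  map_topFace (n : ℕ) : S.map (δ (Fin.last (n + 1))) = topFace O n
  map_degeneracy (n : ℕ) (i : Fin (n + 1)) : S.map (σ i) = degeneracy O n i
  /-- The cell `d_{n+1} d_{n+1} ⟶ d_{n+1} d_{n+2}` on `P(O)_{n+2}` is `β_n`. -/
  square_top (n : ℕ) :
    (S.square (δ_comp_δ_self (i := Fin.last (n + 1)))).hom =
      eqToHom (congrArg₂ (· ⋙ ·) (map_face (n + 1) (Fin.last (n + 1))) (map_topFace n)) ≫
        β O n ≫
        eqToHom (congrArg₂ (· ⋙ ·) (map_topFace (n + 1)) (map_topFace n)).symm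
  /-- `d_j d_i ⟶ d_i d_{j+1}` for `i ≤ j`, not both top faces. -/
  square_face_face (n : ℕ) (i j : Fin (n + 2)) (h : i ≤ j) (hi : i ≠ Fin.last (n + 1)) :
    IsIdentity (S.square (δ_comp_δ h).symm).hom
  /-- `d_i s_{j+1} ⟶ s_j d_i` for `i ≤ j`. -/
  square_face_degeneracy_of_le (n : ℕ) (i : Fin (n + 2)) (j : Fin (n + 1))
    (h : i ≤ j.castSucc) : IsIdentity (S.square (δ_comp_σ_of_le h)).hom
  /-- `d_{i+1} s_j ⟶ s_j d_i` for `i > j`. -/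
  square_face_degeneracy_of_gt (n : ℕ) (i : Fin (n + 2)) (j : Fin (n + 1))
    (h : j.castSucc < i) : IsIdentity (S.square (δ_comp_σ_of_gt h)).hom
  /-- `1 ⟶ d_i s_i`. -/
  triangle_castSucc (n : ℕ) (i : Fin (n + 1)) :
    IsIdentity (S.triangle (δ_comp_σ_self (i := i))).hom
  /-- `1 ⟶ d_{i+1} s_i`. -/
  triangle_succ (n : ℕ) (i : Fin (n + 1)) :
    IsIdentity (S.triangle (δ_comp_σ_succ (i := i))).hom
  /-- `s_i s_j ⟶ s_{j+1} s_i` for `i ≤ j`. -/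
  square_degeneracy_degeneracy (n : ℕ) (i j : Fin (n + 1)) (h : i ≤ j) :
    IsIdentity (S.square (σ_comp_σ h)).hom

end PitaNerve

/-!
When all quasibijections are invertible, the unit `π_n : id ⟶ i_n r_n` is an isomorphism, and
`r_n i_n` is the identity on the nose, because the pita factorisation of an order-preserving
morphism is trivial. So `r_n` and `i_n` are inverse equivalences, along which the strict simplicial
structure of `W(O)` is transported to `P(O)`: the operator attached to `α` is `r α^* i`, and the
composition constraint of `α` and `γ` is `r α^* π γ^* i`.

This constraint is an identity if `γ` preserves the last element, since then `γ^* i` takes values in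
locally order-preserving chains, where `π` is an identity. It is also an identity if `α` preserves
the last element, since then `α^* π` agrees with the unit at `α^*`, which `r` sends to an identity.
The only composite in the simplicial identities with neither property is `d_{n+1} d_{n+2}`, whose
constraint is `β_n`.
-/

namespace PitaNerve

open OperadicCategory SimplexCategory Simplicial

universe v₂ w₂

/-! ### Identities up to an equality of objects -/

/-- A morphism is an identity modulo an equality of its source and target. For natural
transformations, seen as morphisms of a functor category, this is `IsIdentity`. -/
def IsEqToHom {C : Type*} [Category* C] {X Y : C} (f : X ⟶ Y) : Prop :=
  ∃ h : X = Y, f = eqToHom h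

section IsEqToHom

variable {C : Type*} [Category* C] {D : Type*} [Category* D]

lemma isEqToHom_eqToHom {X Y : C} (h : X = Y) : IsEqToHom (eqToHom h) := ⟨h, rfl⟩

lemma isEqToHom_id (X : C) : IsEqToHom (𝟙 X) := isEqToHom_eqToHom rfl

namespace IsEqToHom

lemma comp {X Y Z : C} {f : X ⟶ Y} {g : Y ⟶ Z} (hf : IsEqToHom f) (hg : IsEqToHom g) :
    IsEqToHom (f ≫ g) := by
  obtain ⟨hXY, rfl⟩ := hf
  obtain ⟨hYZ, rfl⟩ := hg
  exact ⟨hXY.trans hYZ, eqToHom_trans hXY hYZ⟩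

lemma map (F : C ⥤ D) {X Y : C} {f : X ⟶ Y} (hf : IsEqToHom f) : IsEqToHom (F.map f) := by
  obtain ⟨h, rfl⟩ := hf
  exact ⟨congrArg F.obj h, eqToHom_map F h⟩

lemma inv {X Y : C} {e : X ≅ Y} (he : IsEqToHom e.hom) : IsEqToHom e.inv := by
  obtain ⟨h, he⟩ := he
  obtain rfl : e = eqToIso h := Iso.ext he
  exact ⟨h.symm, rfl⟩

lemma eq {X Y : C} {f g : X ⟶ Y} (hf : IsEqToHom f) (hg : IsEqToHom g) : f = g := by
  obtain ⟨_, rfl⟩ := hf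
  obtain ⟨_, rfl⟩ := hg
  rfl

lemma app {F G : C ⥤ D} {t : F ⟶ G} (ht : IsEqToHom t) (X : C) : IsEqToHom (t.app X) := by
  obtain ⟨h, rfl⟩ := ht
  exact ⟨congrArg (fun H : C ⥤ D => H.obj X) h, eqToHom_app h X⟩

lemma of_app {F G : C ⥤ D} {t : F ⟶ G} (ht : ∀ X, IsEqToHom (t.app X)) : IsEqToHom t := by
  obtain rfl : F = G := CategoryTheory.Functor.ext (fun X => (ht X).1) fun X Y f => by
    have hnat : F.map f ≫ eqToHom (ht Y).1 = eqToHom (ht X).1 ≫ G.map f := by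
      rw [← (ht X).2, ← (ht Y).2, t.naturality f]
    rw [← Category.assoc, ← hnat, Category.assoc, eqToHom_trans, eqToHom_refl, Category.comp_id]
  exact ⟨rfl, NatTrans.ext (funext fun X => (ht X).2)⟩

end IsEqToHom

end IsEqToHom

/-! ### Transport of pseudo-simplicial structures -/

namespace PseudoSimplicial

variable {X : SimplexCategory → Type w} [∀ a, Category.{v} (X a)]

lemma isIdentity_square (S : PseudoSimplicial X) {a b b' c : SimplexCategory} {α : a ⟶ b}
    {γ : b ⟶ c} {α' : a ⟶ b'} {γ' : b' ⟶ c} (w : α ≫ γ = α' ≫ γ')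
    (h : IsEqToHom (S.mapComp α γ).hom) (h' : IsEqToHom (S.mapComp α' γ').hom) :
    IsIdentity (S.square w).hom :=
  h.inv.comp ((isEqToHom_eqToHom (congrArg S.map w)).comp h')

lemma isIdentity_triangle (S : PseudoSimplicial X) {a b : SimplexCategory} {α : a ⟶ b}
    {γ : b ⟶ a} (w : α ≫ γ = 𝟙 a) (h : IsEqToHom (S.mapId a).hom)
    (h' : IsEqToHom (S.mapComp α γ).hom) : IsIdentity (S.triangle w).hom :=
  h.inv.comp ((isEqToHom_eqToHom (congrArg S.map w.symm)).comp h')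

lemma map_assoc_comp_map (S : PseudoSimplicial X) {a b c d : SimplexCategory} (α : a ⟶ b)
    (γ : b ⟶ c) (κ : c ⟶ d) {x : X d} {y : X c} (f : (S.map κ).obj x ⟶ y) :
    (S.mapComp (α ≫ γ) κ).hom.app x ≫ (S.map (α ≫ γ)).map f ≫ (S.mapComp α γ).hom.app y =
      eqToHom (by rw [Category.assoc]) ≫ (S.mapComp α (γ ≫ κ)).hom.app x ≫
        (S.map α).map ((S.mapComp γ κ).hom.app x) ≫ (S.map α).map ((S.map γ).map f) := by
  rw [NatTrans.naturality, reassoc_of% S.map_assoc α γ κ x]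
  rfl

lemma map_id_comp_map (S : PseudoSimplicial X) {a b : SimplexCategory} (α : a ⟶ b) {x : X b}
    {y : X a} (f : (S.map α).obj x ⟶ y) :
    (S.mapComp (𝟙 a) α).hom.app x ≫ (S.map (𝟙 a)).map f ≫ (S.mapId a).hom.app y =
      eqToHom (by rw [Category.id_comp]) ≫ f := by
  rw [NatTrans.naturality, reassoc_of% S.map_id_comp α x]
  rfl

variable {Y : SimplexCategory → Type w₂} [∀ a, Category.{v₂} (Y a)]

/-- Transport of a pseudo-simplicial category along equivalences with its values: the operator
attached to `α` is conjugated by the equivalences, and the composition constraints are those of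
`S`, followed by the unit of the equivalence in the middle. -/
def transport (S : PseudoSimplicial X) (e : ∀ a, X a ≌ Y a) : PseudoSimplicial Y where
  map {a b} α := (e b).inverse ⋙ S.map α ⋙ (e a).functor
  mapId a := Functor.isoWhiskerLeft (e a).inverse
    (Functor.isoWhiskerRight (S.mapId a) (e a).functor) ≪≫ (e a).counitIso
  mapComp {a b c} α γ := Functor.isoWhiskerLeft (e c).inverse (Functor.isoWhiskerRight
    (S.mapComp α γ ≪≫ Functor.isoWhiskerLeft (S.map γ)
      (Functor.isoWhiskerRight (e b).unitIso (S.map α))) (e a).functor)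
  map_assoc {a b c d} α γ κ y := by
    have := (e a).functor.congr_map (S.map_assoc_comp_map α γ κ
      ((e c).unitIso.hom.app ((S.map κ).obj ((e d).inverse.obj y))))
    simp only [Functor.comp_obj, Functor.map_comp, eqToHom_map] at this
    simp [reassoc_of% this]
  map_id_comp {a b} α y := by
    have := (e a).functor.congr_map (S.map_id_comp_map α
      ((e a).unitIso.hom.app ((S.map α).obj ((e b).inverse.obj y))))
    simp only [Functor.id_obj, Functor.comp_obj, Functor.map_comp, eqToHom_map] at this
    simp [reassoc_of% this]
  map_comp_id {a b} α y := by
    have := (e a).functor.congr_map (S.map_comp_id α ((e b).inverse.obj y))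
    simp only [Functor.map_comp, eqToHom_map] at this
    simp [this]

end PseudoSimplicial

variable {O : Type u} [Category.{v} O] [OperadicCategory O]

/-! ### The simplicial categories of chains -/

variable (O) in
/-- The strict simplicial category `W(O)`. -/
def W.pseudoSimplicial : PseudoSimplicial (W O) where
  map α := W.map α
  mapId _ := Iso.refl _
  mapComp _ _ := Iso.refl _
  map_assoc _ _ _ _ := ((isEqToHom_id _).comp (isEqToHom_id _)).eq
    ((isEqToHom_eqToHom _).comp ((isEqToHom_id _).comp ((isEqToHom_id _).map _)))
  map_id_comp _ _ := ((isEqToHom_id _).comp (isEqToHom_id _)).eq (isEqToHom_eqToHom _)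
  map_comp_id _ _ := ((isEqToHom_id _).comp ((isEqToHom_id _).map _)).eq (isEqToHom_eqToHom _)

lemma W.isEqToHom_of_app {a : SimplexCategory} {X Y : W O a} {f : X ⟶ Y}
    (hf : ∀ k, IsEqToHom (f.app.app k)) : IsEqToHom f := by
  obtain ⟨X⟩ := X
  obtain ⟨Y⟩ := Y
  obtain ⟨rfl : X = Y, happ⟩ := IsEqToHom.of_app (t := f.app) hf
  exact ⟨rfl, W.Hom.ext happ⟩

lemma P.isEqToHom_of_hom {a : SimplexCategory} {X Y : P O a} {f : X ⟶ Y}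
    (hf : IsEqToHom f.hom) : IsEqToHom f := by
  obtain ⟨X, hX⟩ := X
  obtain ⟨Y, hY⟩ := Y
  obtain ⟨rfl : X = Y, hhom⟩ := hf
  exact ⟨rfl, ObjectProperty.hom_ext _ hhom⟩

/-! ### Invertible quasibijections -/

/-- The fibres of `τ` are among those of `τ ≫ σ`, as the fibres of `σ` are trivial. -/
lemma IsQuasibijection.of_comp {R T S : O} {τ : R ⟶ T} {σ : T ⟶ S}
    (hσ : IsQuasibijection σ) (hτσ : IsQuasibijection (τ ≫ σ)) : IsQuasibijection τ := by
  intro i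
  obtain ⟨j, hj⟩ := SkFin.exists_ε (card.map σ) (card.map σ i) i rfl
  have hcard := congrArg SkFin.len (Functor.congr_obj (fibre_card S (card.map σ i)) (Over.mk σ))
  have hfibre : (fibre S (card.map σ i)).obj (Over.mk (τ ≫ σ)) =
      (fibre T (SkFin.ε (card.map σ) (card.map σ i) j)).obj (Over.mk τ) :=
    ((hσ (card.map σ i)).fibre_obj ((fibre S (card.map σ i)).map
      (Over.homMk τ : Over.mk (τ ≫ σ) ⟶ Over.mk σ)) (Fin.cast hcard.symm j)).symm.trans
      (Functor.congr_obj (fibre_fibre (Over.mk σ) (card.map σ i) (Fin.cast hcard.symm j))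
        (Over.mk τ))
  rw [← hj, ← hfibre]
  exact hτσ _

lemma FibrewiseOrderPreserving.of_comp_eq_id {T T' S S' : O} {σ : T ⟶ T'} {σ' : T' ⟶ T}
    {f : T ⟶ S} {g : T' ⟶ S'} {τ : S ⟶ S'} (h : FibrewiseOrderPreserving σ g)
    (hσ : σ' ≫ σ = 𝟙 T') (w : f ≫ τ = σ ≫ g) : FibrewiseOrderPreserving σ' f := by
  rw [fibrewiseOrderPreserving_iff] at h ⊢
  intro x y hxy hfxy
  have hσ_apply : ∀ z, card.map σ (card.map σ' z) = z := fun z => by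
    rw [← card_map_comp_apply, hσ, card_map_id_apply]
  have hw_apply : ∀ z, card.map g (card.map σ z) = card.map τ (card.map f z) := fun z => by
    rw [← card_map_comp_apply, ← w, card_map_comp_apply]
  by_contra hlt
  have hyx : y ≤ x := by
    simpa only [hσ_apply] using
      h _ _ (not_le.1 hlt).le (by rw [hw_apply, hw_apply, hfxy])
  exact hlt (congrArg (card.map σ') (le_antisymm hxy hyx)).le

lemma W.isIso_of_app {a : SimplexCategory} {X Y : W O a} (f : X ⟶ Y)
    [∀ k, IsIso (f.app.app k)] : IsIso f := by
  have : IsIso f.app := NatIso.isIso_of_isIso_app _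
  have hinv : ∀ k, (inv f.app).app k ≫ f.app.app k = 𝟙 _ := fun k => by
    rw [← NatTrans.comp_app, IsIso.inv_hom_id, NatTrans.id_app]
  let g : Y ⟶ X :=
    W.Hom.mk (inv f.app)
      (fun k => (f.isQuasibijection k).of_comp (hinv k ▸ isQuasibijection_id _))
      (fun k => (f.fibrewise k).of_comp_eq_id (hinv k) (f.app.naturality _))
  exact ⟨g, W.Hom.ext (IsIso.hom_inv_id f.app), W.Hom.ext (IsIso.inv_hom_id f.app)⟩

lemma W.isGroupoid (hqb : ∀ (T S : O) (σ : T ⟶ S), IsQuasibijection σ → IsIso σ)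
    (a : SimplexCategory) : IsGroupoid (W O a) where
  all_isIso f :=
    have (k : Fin (a.len + 1)) : IsIso (f.app.app k) := hqb _ _ _ (f.isQuasibijection k)
    W.isIso_of_app f

/-! ### The reflection on locally order-preserving chains -/

/-- A simplicial operator preserves the last element if it acts on chains without changing their
last object `T_0`. -/
abbrev PreservesLast {a b : SimplexCategory} (α : a ⟶ b) : Prop :=
  α.toOrderHom (Fin.last a.len) = Fin.last b.len

lemma preservesLast_δ {n : ℕ} {i : Fin (n + 2)} (hi : i ≠ Fin.last (n + 1)) :
    PreservesLast (δ i) := by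
  obtain ⟨i, rfl⟩ := Fin.exists_castSucc_eq.2 hi
  exact δ_castSucc_last i

variable [StrictlyFactorisable O]

lemma isEqToHom_pita_π {T R : O} {f : T ⟶ R} (hf : IsOrderPreserving f) :
    IsEqToHom (pita f).π := by
  rw [(pita_fibrewise f).eq (PitaFactorisation.ofOrd_fibrewise f hf)]
  exact isEqToHom_id T

lemma isEqToHom_unit_app {a : SimplexCategory} {X : W O a} (hX : locallyOrderPreserving O a X) :
    IsEqToHom ((unit O a).app X) :=
  W.isEqToHom_of_app fun k => isEqToHom_pita_π (hX k)

lemma incl_comp_refl (a : SimplexCategory) : incl O a ⋙ refl O a = 𝟭 (P O a) := by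
  let t : 𝟭 (P O a) ⟶ incl O a ⋙ refl O a :=
    { app X := ObjectProperty.homMk ((unit O a).app X.obj)
      naturality _ _ f := ObjectProperty.hom_ext _ ((unit O a).naturality f.hom) }
  have ht : IsEqToHom t :=
    IsEqToHom.of_app fun X => P.isEqToHom_of_hom (isEqToHom_unit_app X.property)
  exact ht.1.symm

lemma reflChain_map_toLast {a : SimplexCategory} (X : W O a) (k : Fin (a.len + 1)) :
    (reflChain X).map (toLast k) =
      (pita (X.chain.map (toLast k))).η ≫ (pita (X.chain.map (toLast (Fin.last a.len)))).π := by
  have hfac : X.chain.map (toLast k) ≫ X.chain.map (toLast (Fin.last a.len)) =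
      X.chain.map (toLast k) := (X.chain.map_comp _ _).symm
  refine (existsUnique_etaLift _ _ _ hfac).unique
    ⟨π_etaLift _ _ _ hfac, etaLift_η _ _ _ hfac⟩ ⟨?_, ?_⟩
  · rw [← Category.assoc, PitaFactorisation.fac]
  · have hlast : X.chain.map (toLast (Fin.last a.len)) = 𝟙 _ := X.chain.map_id _
    rw [Category.assoc, PitaFactorisation.fac, hlast, Category.comp_id]

/-- The index `l` is kept apart from `Fin.last b.len` because a simplicial operator `α` with
`PreservesLast α` sends the last element to the last element only propositionally. -/
lemma exists_isEqToHom_pita_mid {b : SimplexCategory} (X : W O b) {k l : Fin (b.len + 1)}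
    (m : k ⟶ l) (hl : l = Fin.last b.len) :
    ∃ e : (pita (X.chain.map m)).mid ⟶ (pita (X.chain.map (toLast k))).mid, IsEqToHom e ∧
      (pita (X.chain.map m)).π ≫ e = (pita (X.chain.map (toLast k))).π ∧
      e ≫ (reflChain X).map m =
        (pita (X.chain.map m)).η ≫ (pita (X.chain.map (toLast l))).π := by
  subst hl
  obtain rfl : m = toLast k := Subsingleton.elim _ _
  exact ⟨𝟙 _, isEqToHom_id _, Category.comp_id _,
    (Category.id_comp _).trans (reflChain_map_toLast X k)⟩

lemma reflApp_eq {a : SimplexCategory} {X Y : W O a} (f : X ⟶ Y) (k : Fin (a.len + 1))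
    (e : (pita (X.chain.map (toLast k))).mid ⟶ Y.chain.obj k)
    (hπ : (pita (X.chain.map (toLast k))).π ≫ e = f.app.app k)
    (hη : e ≫ Y.chain.map (toLast k) =
      (pita (X.chain.map (toLast k))).η ≫ f.app.app (Fin.last a.len)) :
    reflApp f k = e ≫ (pita (Y.chain.map (toLast k))).π := by
  refine omega_ext _ (f.isQuasibijection (Fin.last a.len)) (pita _).isOrderPreserving ?_
    (reflApp_η f k) ?_
  · rw [π_reflApp, ← Category.assoc, hπ]
  · rw [Category.assoc, PitaFactorisation.fac, hη]

lemma isEqToHom_refl_map_unit {a b : SimplexCategory} {α : a ⟶ b} (hα : PreservesLast α)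
    (X : W O b) : IsEqToHom ((refl O a).map ((W.map α).map ((unit O b).app X))) := by
  refine P.isEqToHom_of_hom (W.isEqToHom_of_app fun k => ?_)
  obtain ⟨e, he, hπ, hη⟩ :=
    exists_isEqToHom_pita_mid X (α.toOrderHom.monotone.functor.map (toLast k)) hα
  have hmono := ((P.restrict O α hα).obj ((refl O b).obj X)).property k
  have happ := reflApp_eq ((W.map α).map ((unit O b).app X)) k e hπ hη
  exact happ.symm.subst (motive := IsEqToHom) (he.comp (isEqToHom_pita_π hmono))

/-! ### The pita nerve -/

section

variable [∀ a, IsIso (unit O a)]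

variable (O) in
/-- If the unit `π_n` is invertible, the reflection `r_n` is an equivalence with inverse `i_n`. -/
noncomputable def reflEquivalence (a : SimplexCategory) : W O a ≌ P O a where
  functor := refl O a
  inverse := incl O a
  unitIso := asIso (unit O a)
  counitIso := eqToIso (incl_comp_refl a)
  functor_unitIso_comp X :=
    ((isEqToHom_refl_map_unit (α := 𝟙 a) rfl X).comp
      ((isEqToHom_eqToHom (incl_comp_refl a)).app _)).eq (isEqToHom_id _)

variable (O) in
/-- The pita nerve as a pseudo-simplicial category, transported from the strict simplicial category
`W(O)`. -/
noncomputable def pitaNerve : PseudoSimplicial (P O) :=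
  (W.pseudoSimplicial O).transport (reflEquivalence O)

lemma pitaNerve_map {a b : SimplexCategory} {α : a ⟶ b} (hα : PreservesLast α) :
    (pitaNerve O).map α = P.restrict O α hα :=
  congrArg (P.restrict O α hα ⋙ ·) (incl_comp_refl a)

lemma pitaNerve_mapComp_hom {a b c : SimplexCategory} (α : a ⟶ b) (γ : b ⟶ c) :
    ((pitaNerve O).mapComp α γ).hom =
      Functor.whiskerLeft (incl O c ⋙ W.map γ)
        (Functor.whiskerRight (unit O b) (W.map α ⋙ refl O a)) := by
  ext X : 2
  exact congrArg (refl O a).map (Category.id_comp _)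

lemma isEqToHom_pitaNerve_mapId (a : SimplexCategory) :
    IsEqToHom ((pitaNerve O).mapId a).hom :=
  .of_app fun X => ((isEqToHom_id X.obj).map (refl O a)).comp
    ((isEqToHom_eqToHom (incl_comp_refl (O := O) a)).app X)

lemma isEqToHom_pitaNerve_mapComp_of_left {a b c : SimplexCategory} {α : a ⟶ b}
    (hα : PreservesLast α) (γ : b ⟶ c) : IsEqToHom ((pitaNerve O).mapComp α γ).hom := by
  rw [pitaNerve_mapComp_hom]
  exact .of_app fun _ => isEqToHom_refl_map_unit hα _

lemma isEqToHom_pitaNerve_mapComp_of_right {a b c : SimplexCategory} (α : a ⟶ b) {γ : b ⟶ c}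
    (hγ : PreservesLast γ) : IsEqToHom ((pitaNerve O).mapComp α γ).hom := by
  rw [pitaNerve_mapComp_hom]
  exact .of_app fun X =>
    (isEqToHom_unit_app ((P.restrict O γ hγ).obj X).property).map (W.map α ⋙ refl O a)

lemma pitaNerve_square_top (n : ℕ) :
    ((pitaNerve O).square (δ_comp_δ_self (i := Fin.last (n + 1)))).hom =
      eqToHom (congrArg (· ⋙ topFace O n) (pitaNerve_map (δ_castSucc_last (Fin.last (n + 1))))) ≫
        β O n := by
  have hprefix : ((pitaNerve O).mapComp (δ (Fin.last (n + 1)))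
        (δ (Fin.last (n + 1)).castSucc)).inv ≫
      eqToHom (congrArg (pitaNerve O).map (δ_comp_δ_self (i := Fin.last (n + 1)))) =
      eqToHom (congrArg (· ⋙ topFace O n)
        (pitaNerve_map (δ_castSucc_last (Fin.last (n + 1))))) ≫ eqToHom (face_comp_topFace O n) :=
    ((isEqToHom_pitaNerve_mapComp_of_right _ (δ_castSucc_last _)).inv.comp
      (isEqToHom_eqToHom _)).eq ((isEqToHom_eqToHom _).comp (isEqToHom_eqToHom _))
  let unitCell := ((pitaNerve O).mapComp (δ (Fin.last (n + 1))) (δ (Fin.last (n + 1)).succ)).hom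
  have hβ : β O n = eqToHom (face_comp_topFace O n) ≫ unitCell := by
    rw [β, ← pitaNerve_mapComp_hom]
    rfl
  rw [hβ]
  exact (Category.assoc _ _ unitCell).symm.trans
    ((congrArg (· ≫ unitCell) hprefix).trans (Category.assoc _ _ unitCell))

lemma isPitaNerve_pitaNerve : (pitaNerve O).IsPitaNerve where
  map_face _ i := pitaNerve_map (δ_castSucc_last i)
  map_topFace _ := rfl
  map_degeneracy _ i := pitaNerve_map (σ_last i)
  square_top n := (pitaNerve_square_top n).trans
    (congrArg (eqToHom _ ≫ ·) (Category.comp_id (β O n)).symm)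
  square_face_face _ _ _ _ hi := (pitaNerve O).isIdentity_square _
    (isEqToHom_pitaNerve_mapComp_of_right _ (δ_castSucc_last _))
    (isEqToHom_pitaNerve_mapComp_of_left (preservesLast_δ hi) _)
  square_face_degeneracy_of_le _ _ _ _ := (pitaNerve O).isIdentity_square _
    (isEqToHom_pitaNerve_mapComp_of_right _ (σ_last _))
    (isEqToHom_pitaNerve_mapComp_of_left (σ_last _) _)
  square_face_degeneracy_of_gt _ _ _ _ := (pitaNerve O).isIdentity_square _
    (isEqToHom_pitaNerve_mapComp_of_right _ (σ_last _))
    (isEqToHom_pitaNerve_mapComp_of_left (σ_last _) _)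
  triangle_castSucc _ i := (pitaNerve O).isIdentity_triangle _ (isEqToHom_pitaNerve_mapId _)
    (isEqToHom_pitaNerve_mapComp_of_right _ (σ_last i))
  triangle_succ _ i := (pitaNerve O).isIdentity_triangle _ (isEqToHom_pitaNerve_mapId _)
    (isEqToHom_pitaNerve_mapComp_of_right _ (σ_last i))
  square_degeneracy_degeneracy _ _ _ _ := (pitaNerve O).isIdentity_square _
    (isEqToHom_pitaNerve_mapComp_of_right _ (σ_last _))
    (isEqToHom_pitaNerve_mapComp_of_right _ (σ_last _))

end

end PitaNerve

theorem mainTheorem3 {O : Type u} [Category.{v} O] [PitaNerve.OperadicCategory O]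
    [PitaNerve.StrictlyFactorisable O]
    (hqb : ∀ (T S : O) (σ : T ⟶ S), PitaNerve.IsQuasibijection σ → IsIso σ) :
    ∃ (hgpd : ∀ a : SimplexCategory, IsGroupoid (PitaNerve.P O a))
      (N : Pseudofunctor (LocallyDiscrete SimplexCategoryᵒᵖ) PitaNerve.Gpd.{v, max u v})
      (S : PitaNerve.PseudoSimplicial (PitaNerve.P O)),
      N = S.toPseudofunctor hgpd ∧ S.IsPitaNerve := by
  have hW := PitaNerve.W.isGroupoid hqb
  have hP (a : SimplexCategory) : IsGroupoid (PitaNerve.P O a) :=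
    isGroupoid_of_reflects_iso (PitaNerve.incl O a)
  have hunit (a : SimplexCategory) : IsIso (PitaNerve.unit O a) :=
    NatIso.isIso_of_isIso_app _
  exact ⟨hP, (PitaNerve.pitaNerve O).toPseudofunctor hP, PitaNerve.pitaNerve O, rfl,
    PitaNerve.isPitaNerve_pitaNerve⟩
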